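/- For $n\ge 1$ let $\mathbf{\Sigma}^1_n,\mathbf{\Pi}^1_n,\mathbf{\Delta}^1_n$ be the boldface projective classes of subsets of Polish spaces: $\mathbf{\Sigma}^1_1$ is the class of analytic sets; a set is $\mathbf{\Pi}^1_n$ if its complement is $\mathbf{\Sigma}^1_n$; a subset of $V$ is $\mathbf{\Sigma}^1_{n+1}$ if it is the projection of a $\mathbf{\Pi}^1_n$ subset of $\omega^\omega\times V$; and $\mathbf{\Delta}^1_n=\mathbf{\Sigma}^1_n\cap\mathbf{\Pi}^1_n$. These classes ($n\ge1$) are called the Lusin pointclasses. Let $\mathbf{P}$ be a Lusin pointclass. A function between Polish spaces is called a $\mathbf{P}$ function if the preimage of every open set is in $\mathbf{P}$. For a graph $G$ on a Polish space $V$, let $\chi_{\mathbf{P}}(G)$ be the least cardinal $\kappa$ such that $G$ has a proper colouring with a set of $\kappa$ colours in which every colour class is in $\mathbf{P}$. Theorem. Let $\mathbf{P}$ be a Lusin pointclass, let $V$ be a Polish space, let $f_0,f_1,f_2:V\to V$ be $\mathbf{P}$ functions, and let $G=(V,E)$ be the graph that they generate, that is, $$E=\{(v,w)\in V\times V : v\neq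 w\ \wedge\ \exists i\in\{0,1,2\}\ (f_i(v)=w\ \vee\ f_i(w)=v)\}.$$ Then either $\chi_{\mathbf{P}}(G)\le 8$, or $\chi_{\mathbf{P}}(G)$ is infinite. -/

import Mathlib

open Cardinal

universe u

/-- The boldface class `Σ¹_{n+1}` on the topological space `X` (index shifted by one, so that `n = 0`
is the class of analytic sets). A set is `Σ¹_{n+2}` if it is the projection along the Baire space
`ℕ → ℕ` of a `Π¹_{n+1}` set, that is, of the complement of a `Σ¹_{n+1}` set. -/
def IsSigmaOne : ℕ → ∀ (X : Type u) [TopologicalSpace X], Set X → Prop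
  | 0, _, _, A => MeasureTheory.AnalyticSet A
  | n + 1, X, _, A => ∃ B : Set ((ℕ → ℕ) × X), IsSigmaOne n ((ℕ → ℕ) × X) Bᶜ ∧ Prod.snd '' B = A

/-- The Lusin pointclasses: `sigma n`, `pi n`, `delta n` stand for the boldface classes
`Σ¹_{n+1}`, `Π¹_{n+1}`, `Δ¹_{n+1}`, where `n = 0, 1, 2, …`. -/
inductive LusinPointclass : Type where
  | sigma (n : ℕ) : LusinPointclass
  | pi (n : ℕ) : LusinPointclass
  | delta (n : ℕ) : LusinPointclass

namespace LusinPointclass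

/-- `P.Mem A`: the subset `A` of the (Polish) space `X` belongs to the pointclass `P`. -/
def Mem (P : LusinPointclass) {X : Type u} [TopologicalSpace X] (A : Set X) : Prop :=
  match P with
  | sigma n => IsSigmaOne n X A
  | pi n => IsSigmaOne n X Aᶜ
  | delta n => IsSigmaOne n X A ∧ IsSigmaOne n X Aᶜ

/-- A `P` function (`P`-measurable function): the preimage of every open set is in `P`. -/
def IsFunction (P : LusinPointclass) {X Y : Type u} [TopologicalSpace X] [TopologicalSpace Y]
    (f : X → Y) : Prop :=
  ∀ U : Set Y, IsOpen U → P.Mem (f ⁻¹' U)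

/-- A `P` class colouring: every colour class is in `P`. -/
def IsClassColoring (P : LusinPointclass) {V A : Type u} [TopologicalSpace V] {G : SimpleGraph V}
    (c : G.Coloring A) : Prop :=
  ∀ a : A, P.Mem {w : V | c w = a}

/-- The `P` class chromatic number `χ_P(G)`: the least cardinal `κ` such that `G` has a `P` class
colouring with a set of colours of cardinality `κ`. -/
noncomputable def chromaticNumber (P : LusinPointclass) {V : Type u} [TopologicalSpace V]
    (G : SimpleGraph V) : Cardinal.{u} :=
  sInf {κ : Cardinal.{u} | ∃ (A : Type u) (c : G.Coloring A), #A = κ ∧ P.IsClassColoring c}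

end LusinPointclass

/-- The graph generated by a family of functions `f i : V → V`. -/
def generatedGraph {ι : Type*} {V : Type u} (f : ι → V → V) : SimpleGraph V where
  Adj v w := v ≠ w ∧ ∃ i, f i v = w ∨ f i w = v
  symm := ⟨fun _ _ ⟨h, i, hi⟩ => ⟨h.symm, i, hi.symm⟩⟩
  loopless := ⟨fun _ h => h.1 rfl⟩

theorem isSigmaOne_of_isOpen_or_isClosed (n : ℕ) : ∀ (X : Type u) [TopologicalSpace X]
    [PolishSpace X] (A : Set X), (IsOpen A ∨ IsClosed A) → IsSigmaOne n X A := by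
  induction n with
  | zero =>
    intro X _ _ A h
    letI : MeasurableSpace X := borel X
    haveI : BorelSpace X := ⟨rfl⟩
    exact MeasurableSet.analyticSet (h.elim IsOpen.measurableSet IsClosed.measurableSet)
  | succ n ih =>
    intro X _ _ A h
    refine ⟨Prod.snd ⁻¹' A, ih _ _ ?_, Set.image_preimage_eq _ Prod.snd_surjective⟩
    rcases h with h | h
    · exact Or.inr (h.preimage continuous_snd).isClosed_compl
    · exact Or.inl (h.preimage continuous_snd).isOpen_compl

namespace LusinPointclass

theorem mem_of_isOpen_or_isClosed (P : LusinPointclass) {X : Type u} [TopologicalSpace X]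
    [PolishSpace X] (A : Set X) (h : IsOpen A ∨ IsClosed A) : P.Mem A := by
  have h' : IsOpen Aᶜ ∨ IsClosed Aᶜ := by
    rcases h with h | h
    · exact Or.inr h.isClosed_compl
    · exact Or.inl h.isOpen_compl
  cases P with
  | sigma n => exact isSigmaOne_of_isOpen_or_isClosed n X A h
  | pi n => exact isSigmaOne_of_isOpen_or_isClosed n X Aᶜ h'
  | delta n => exact ⟨isSigmaOne_of_isOpen_or_isClosed n X A h,
      isSigmaOne_of_isOpen_or_isClosed n X Aᶜ h'⟩

/-- The infimum in `chromaticNumber` is attained: colouring each point by itself is a `P` class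
colouring, so the infimum is over a nonempty set of cardinals. -/
theorem exists_coloring_card_eq_chromaticNumber (P : LusinPointclass) {V : Type u}
    [TopologicalSpace V] [PolishSpace V] (G : SimpleGraph V) :
    ∃ (A : Type u) (c : G.Coloring A), #A = P.chromaticNumber G ∧ P.IsClassColoring c := by
  have hne : {κ : Cardinal.{u} | ∃ (A : Type u) (c : G.Coloring A),
      #A = κ ∧ P.IsClassColoring c}.Nonempty :=
    ⟨#V, V, SimpleGraph.Coloring.mk id (fun h => h.ne), rfl, fun a =>
      P.mem_of_isOpen_or_isClosed _ (Or.inr (isClosed_singleton (x := a)))⟩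
  exact csInf_mem hne

end LusinPointclass

/-! ### Kernels along a rank, fixed points, and the basic decomposition. -/

section Combinatorics

open Set

/-! Suppose the chromatic number is finite. The `Δ` sets at the level of `P` form a σ-algebra for
which the three functions and the given finite colouring are measurable, so it suffices to prove a
statement about measurable functions: a finite measurable colouring can be improved to one with
eight colours (`exists_eight_coloring`).

The budget is counted in successors. Call the `f i v` the successors of `v`; there are three. If a
rank decreases along all edges inside a set, the kernel of the set (points with no successor of
smaller rank in the kernel) is independent, and every remaining point has a successor in it. Each
known successor outside the set therefore saves a colour: one exit gives three colours, two exits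
give two.

`exists_decomposition` splits the space into an independent `K`, a ranked `W` whose points exit to
`K ∪ A`, and `A` whose points have a successor in `W`. Then `W` takes three colours, and
`exists_five_isIndepFor_union` takes care of `A ∪ K` with five. For this, `A` is decomposed again
into `M`, `Y`, `Z`. Two colours cover `Y` and absorb every point of `K` except those with successors
in both colours; these exceptions form a set `H`. Points of `Z ∪ H` have at most one successor in `Z
∪ H ∪ M`, and `M` is independent, so three more colours suffice (`exists_three_isIndepFor_union`).

Both of the last two results need choices that depend on each other in a circle along edges with no
rank; these are made by iterating a continuous monotone operator from the empty set. -/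

theorem Fin.eq_or_eq_or_eq_of_three {i j k : Fin 3} (hij : i ≠ j) (hik : i ≠ k) (hjk : j ≠ k)
    (l : Fin 3) : l = i ∨ l = j ∨ l = k := by
  omega

/-- No function of the family maps a point of `S` to a different point of `S`. -/
def IsIndepFor {ι V : Type*} (f : ι → V → V) (S : Set V) : Prop :=
  ∀ v ∈ S, ∀ i, f i v ∈ S → f i v = v

variable {V : Type*} [MeasurableSpace V]

/-- Recursion along a rank: a measurable set whose elements are the points of `B` without a
successor of smaller rank in the set. -/
theorem exists_measurableSet_kernel {ι : Type*} [Countable ι] {f : ι → V → V}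
    (hf : ∀ i, Measurable (f i)) {r : V → ℕ} (hr : Measurable r) {B : Set V}
    (hB : MeasurableSet B) :
    ∃ S : Set V, MeasurableSet S ∧ ∀ v, v ∈ S ↔ v ∈ B ∧ ∀ i, r (f i v) < r v → f i v ∉ S := by
  let T : ℕ → Set V := fun n =>
    Nat.rec ∅ (fun _ T => {v | v ∈ B ∧ ∀ i, r (f i v) < r v → f i v ∉ T}) n
  have hT : ∀ n v, v ∈ T (n + 1) ↔ v ∈ B ∧ ∀ i, r (f i v) < r v → f i v ∉ T n :=
    fun n v => Iff.rfl
  have hmeas : ∀ n, MeasurableSet (T n) := by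
    intro n
    induction n with
    | zero => exact MeasurableSet.empty
    | succ n ih =>
      have : T (n + 1) = B ∩ ⋂ i, ({v | r (f i v) < r v}ᶜ ∪ f i ⁻¹' (T n)ᶜ) := by
        ext v
        simp only [hT, mem_inter_iff, mem_iInter, mem_union, mem_compl_iff, mem_ofPred_eq,
          mem_preimage, imp_iff_not_or]
      rw [this]
      exact hB.inter (MeasurableSet.iInter fun i =>
        (measurableSet_lt (hr.comp (hf i)) hr).compl.union (hf i ih.compl))
  -- Membership of `v` consults only points of smaller rank, so it is settled from stage `r v + 1`
  -- on.
  have hstab : ∀ m v, r v = m → ∀ n, m < n → (v ∈ T n ↔ v ∈ T (m + 1)) := by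
    intro m
    induction m using Nat.strong_induction_on with
    | _ m ih =>
      rintro v rfl n hn
      obtain ⟨n, rfl⟩ := Nat.exists_eq_succ_of_ne_zero (by omega : n ≠ 0)
      rw [Nat.succ_eq_add_one, hT, hT]
      refine and_congr_right fun _ => forall_congr' fun i => imp_congr_right fun hi => not_congr ?_
      rw [ih _ hi _ rfl n (by omega), ih _ hi _ rfl (r v) hi]
  refine ⟨⋃ n, ({v | r v = n} ∩ T (n + 1)), MeasurableSet.iUnion fun n =>
    (hr (measurableSet_singleton n)).inter (hmeas (n + 1)), fun v => ?_⟩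
  have hmem : ∀ w, w ∈ (⋃ n, ({v | r v = n} ∩ T (n + 1))) ↔ w ∈ T (r w + 1) := by
    intro w; simp
  rw [hmem, hT]
  refine and_congr_right fun _ => forall_congr' fun i => imp_congr_right fun hi => not_congr ?_
  rw [hmem]
  exact hstab _ _ rfl _ hi

/-- A measurable set that is chosen greedily along a bounded colouring, from the top down. -/
theorem exists_measurableSet_greedy {ι : Type*} [Countable ι] {f : ι → V → V}
    (hf : ∀ i, Measurable (f i)) {c : V → ℕ} (hc : Measurable c) {N : ℕ} (hN : ∀ v, c v ≤ N)
    {B : Set V} (hB : MeasurableSet B) :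
    ∃ S : Set V, MeasurableSet S ∧ ∀ v, v ∈ S ↔ v ∈ B ∧ ∀ i, c v < c (f i v) → f i v ∉ S := by
  obtain ⟨S, hS, h⟩ := exists_measurableSet_kernel hf (r := fun v => N - c v)
    ((measurable_from_top (f := fun n : ℕ => N - n)).comp hc) hB
  refine ⟨S, hS, fun v => (h v).trans (and_congr_right fun _ => forall_congr' fun i => ?_)⟩
  have h1 := hN v
  have h2 := hN (f i v)
  have : N - c (f i v) < N - c v ↔ c v < c (f i v) := by omega
  rw [this]

/-- A monotone operator on sets that is continuous along increasing sequences and preserves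
measurability has a measurable fixed point. -/
theorem exists_measurableSet_fixedPoint {Φ : Set V → Set V} (hmono : Monotone Φ)
    (hmeas : ∀ C, MeasurableSet C → MeasurableSet (Φ C))
    (hcont : ∀ s : ℕ → Set V, Monotone s → Φ (⋃ n, s n) ⊆ ⋃ n, Φ (s n)) :
    ∃ C, MeasurableSet C ∧ Φ C = C := by
  have hsucc : ∀ n, Φ^[n] ∅ ⊆ Φ^[n + 1] ∅ := by
    intro n
    induction n with
    | zero => exact empty_subset _
    | succ n ih =>
      rw [Function.iterate_succ_apply', Function.iterate_succ_apply']
      exact hmono ih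
  have hs : Monotone fun n => Φ^[n] ∅ := monotone_nat_of_le_succ hsucc
  refine ⟨⋃ n, Φ^[n] ∅, MeasurableSet.iUnion fun n => ?_, ?_⟩
  · induction n with
    | zero => exact MeasurableSet.empty
    | succ n ih =>
      rw [Function.iterate_succ_apply']
      exact hmeas _ ih
  · apply Subset.antisymm
    · refine (hcont _ hs).trans (iUnion_subset fun n => ?_)
      rw [← Function.iterate_succ_apply' Φ n]
      exact subset_iUnion (fun n => Φ^[n] ∅) (n + 1)
    · refine iUnion_subset fun n => (hsucc n).trans ?_
      rw [Function.iterate_succ_apply']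
      exact hmono (subset_iUnion (fun n => Φ^[n] ∅) n)

theorem eventually_mem_of_mem_iUnion {α : Type*} {s : ℕ → Set α} (hs : Monotone s) {x : α}
    (hx : x ∈ ⋃ n, s n) : ∀ᶠ n in Filter.atTop, x ∈ s n := by
  obtain ⟨n, hn⟩ := mem_iUnion.1 hx
  exact Filter.eventually_atTop.2 ⟨n, fun m hm => hs hm hn⟩

variable {f : Fin 3 → V → V}

/-- A set along whose edges a rank decreases, each of whose points has at least two successors
outside the set, is the union of two independent sets. -/
theorem exists_two_isIndepFor (hf : ∀ i, Measurable (f i)) {W : Set V} (hW : MeasurableSet W)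
    {r : V → ℕ} (hr : Measurable r)
    (hdec : ∀ v ∈ W, ∀ i, f i v ∈ W → f i v ≠ v → r (f i v) < r v)
    (hexit : ∀ v ∈ W, ∃ i j, i ≠ j ∧ f i v ∉ W ∧ f j v ∉ W) :
    ∃ S T : Set V, MeasurableSet S ∧ MeasurableSet T ∧ IsIndepFor f S ∧ IsIndepFor f T ∧
      Disjoint S T ∧ S ∪ T = W := by
  obtain ⟨S, hS, h⟩ := exists_measurableSet_kernel hf hr hW
  have hSW : S ⊆ W := fun v hv => ((h v).1 hv).1
  refine ⟨S, W \ S, hS, hW.diff hS, ?_, ?_, disjoint_sdiff_right,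
    union_sdiff_cancel hSW⟩
  · intro v hv i hi
    by_contra hne
    exact ((h v).1 hv).2 i (hdec v (hSW hv) i (hSW hi) hne) hi
  · rintro v ⟨hvW, hvS⟩ i ⟨hiW, hiS⟩
    -- This successor and the two exits use up all three functions, leaving none into `W \ S`.
    have : ∃ k, f k v ∈ S := by
      by_contra! hk
      exact hvS ((h v).2 ⟨hvW, fun i _ => hk i⟩)
    obtain ⟨k, hk⟩ := this
    obtain ⟨a, b, hab, ha, hb⟩ := hexit v hvW
    have hak : a ≠ k := by rintro rfl; exact ha (hSW hk)
    have hbk : b ≠ k := by rintro rfl; exact hb (hSW hk)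
    rcases Fin.eq_or_eq_or_eq_of_three hab hak hbk i with rfl | rfl | rfl
    · exact absurd hiW ha
    · exact absurd hiW hb
    · exact absurd hk hiS

/-- A set along whose edges a rank decreases, each of whose points has a successor outside the
set, is the union of three independent sets. -/
theorem exists_three_isIndepFor (hf : ∀ i, Measurable (f i)) {W : Set V} (hW : MeasurableSet W)
    {r : V → ℕ} (hr : Measurable r)
    (hdec : ∀ v ∈ W, ∀ i, f i v ∈ W → f i v ≠ v → r (f i v) < r v)
    (hexit : ∀ v ∈ W, ∃ i, f i v ∉ W) :
    ∃ S T R : Set V, MeasurableSet S ∧ MeasurableSet T ∧ MeasurableSet R ∧ IsIndepFor f S ∧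
      IsIndepFor f T ∧ IsIndepFor f R ∧ S ∪ T ∪ R = W := by
  obtain ⟨S, hS, h⟩ := exists_measurableSet_kernel hf hr hW
  have hSW : S ⊆ W := fun v hv => ((h v).1 hv).1
  obtain ⟨T, R, hT, hR, hTi, hRi, -, hTR⟩ := exists_two_isIndepFor hf (hW.diff hS) hr
    (fun v hv i hi hne => hdec v hv.1 i hi.1 hne) (by
      rintro v ⟨hvW, hvS⟩
      have : ∃ k, f k v ∈ S := by
        by_contra! hk
        exact hvS ((h v).2 ⟨hvW, fun i _ => hk i⟩)
      obtain ⟨k, hk⟩ := this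
      obtain ⟨a, ha⟩ := hexit v hvW
      exact ⟨a, k, by rintro rfl; exact ha (hSW hk), fun h => ha h.1, fun h => h.2 hk⟩)
  refine ⟨S, T, R, hS, hT, hR, ?_, hTi, hRi, ?_⟩
  · intro v hv i hi
    by_contra hne
    exact ((h v).1 hv).2 i (hdec v (hSW hv) i (hSW hi) hne) hi
  · rw [union_assoc, hTR, union_sdiff_cancel hSW]

/-- Decomposition of a finitely coloured set `B` into an independent set `M`, a set `Y` along whose
edges a rank decreases and each of whose points has a successor in `B` outside `Y`, and a set `Z`
each of whose points has a successor in `Y`. For a given set `U` of points with at least two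
successors outside `B`, the points of `Y ∩ U` are isolated in `Y`. -/
theorem exists_decomposition (hf : ∀ i, Measurable (f i)) {c : V → ℕ} (hc : Measurable c) {N : ℕ}
    (hN : ∀ v, c v ≤ N) (hcol : ∀ v i, f i v ≠ v → c (f i v) ≠ c v) {B U : Set V}
    (hB : MeasurableSet B) (hU : MeasurableSet U)
    (hexit : ∀ u ∈ U, ∃ i j, i ≠ j ∧ f i u ∉ B ∧ f j u ∉ B) :
    ∃ (M Y Z : Set V) (r : V → ℕ), MeasurableSet M ∧ MeasurableSet Y ∧ MeasurableSet Z ∧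
      Measurable r ∧ M ∪ Y ∪ Z = B ∧ Disjoint M Y ∧ Disjoint M Z ∧ Disjoint Y Z ∧
      IsIndepFor f M ∧ (∀ y ∈ Y, ∃ i, f i y ∈ M ∪ Z) ∧ (∀ z ∈ Z, ∃ i, f i z ∈ Y) ∧
      (∀ y ∈ Y, y ∈ U → ∀ i, f i y ∉ Y) ∧ (∀ y ∈ Y, y ∉ U → ∀ i, f i y ∈ U → f i y ∉ Y) ∧
      ∀ y ∈ Y, ∀ i, f i y ∈ Y → f i y ≠ y → r (f i y) < r y := by
  classical
  -- Still a proper colouring, with `U` lifted above everything else: a successor of larger `d` of a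
  -- point of `U` is again in `U`.
  let d : V → ℕ := fun v => if v ∈ U then c v + (N + 1) else c v
  have hd : Measurable d := Measurable.ite hU (hc.add_const _) hc
  have hdU : ∀ v, v ∈ U → d v = c v + (N + 1) := fun v hv => if_pos hv
  have hdO : ∀ v, v ∉ U → d v = c v := fun v hv => if_neg hv
  have hdN : ∀ v, d v ≤ 2 * N + 1 := by
    intro v
    have := hN v
    by_cases hv : v ∈ U
    · rw [hdU v hv]; omega
    · rw [hdO v hv]; omega
  have hdcol : ∀ v i, f i v ≠ v → d (f i v) ≠ d v := by
    intro v i hne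
    have h1 := hN v
    have h2 := hN (f i v)
    have h3 := hcol v i hne
    by_cases hv : v ∈ U <;> by_cases hiv : f i v ∈ U
    · rw [hdU _ hv, hdU _ hiv]; omega
    · rw [hdU _ hv, hdO _ hiv]; omega
    · rw [hdO _ hv, hdU _ hiv]; omega
    · rw [hdO _ hv, hdO _ hiv]; omega
  -- Inside `R` edges go down in `d`, and points of `B \ R` have a successor in `R`. Hence `M` is
  -- independent and every point of `R \ M` has a successor in `M`.
  obtain ⟨R, hR, hRmem⟩ := exists_measurableSet_greedy hf hd hdN hB
  obtain ⟨M, hM, hMmem⟩ := exists_measurableSet_kernel hf hd hR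
  have hRB : R ⊆ B := fun v hv => ((hRmem v).1 hv).1
  have hMR : M ⊆ R := fun v hv => ((hMmem v).1 hv).1
  have hRdown : ∀ v ∈ R, ∀ i, f i v ∈ R → f i v ≠ v → d (f i v) < d v := by
    intro v hv i hi hne
    refine lt_of_le_of_ne (not_lt.1 fun hlt => ((hRmem v).1 hv).2 i hlt hi) (hdcol v i hne)
  have hRout : ∀ v ∈ B, v ∉ R → ∃ i, d v < d (f i v) ∧ f i v ∈ R := by
    intro v hv hvR
    by_contra! h
    exact hvR ((hRmem v).2 ⟨hv, h⟩)
  have hMout : ∀ v ∈ R, v ∉ M → ∃ i, f i v ∈ M := by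
    intro v hv hvM
    by_contra! h
    exact hvM ((hMmem v).2 ⟨hv, fun i _ => h i⟩)
  have hMind : IsIndepFor f M := by
    intro v hv i hi
    by_contra hne
    exact ((hMmem v).1 hv).2 i (hRdown v (hMR hv) i (hMR hi) hne) hi
  have hex : ∀ {S : Set V}, MeasurableSet S → MeasurableSet {v | ∃ i, f i v ∈ S} := by
    intro S hS
    rw [ofPred_exists]
    exact MeasurableSet.iUnion fun i => hf i hS
  -- `Y` is built in three layers. A point with a successor in an earlier layer is kept out of the
  -- later ones, so edges between layers only lead forward.
  let Y₁ : Set V := (U ∩ B ∩ {v | ∃ i, f i v ∈ M}) \ M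
  have hY₁ : MeasurableSet Y₁ := ((hU.inter hB).inter (hex hM)).diff hM
  let Y₂ : Set V := ((R \ M) \ U) \ {v | ∃ i, f i v ∈ Y₁}
  have hY₂ : MeasurableSet Y₂ := ((hR.diff hM).diff hU).diff (hex hY₁)
  let B' : Set V := (((B \ M) \ Y₁) \ Y₂) \ {v | ∃ i, f i v ∈ Y₁ ∪ Y₂}
  have hB' : MeasurableSet B' := (((hB.diff hM).diff hY₁).diff hY₂).diff (hex (hY₁.union hY₂))
  obtain ⟨Y₃, hY₃, hY₃mem⟩ := exists_measurableSet_greedy hf hc hN hB'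
  have hY₃B' : Y₃ ⊆ B' := fun v hv => ((hY₃mem v).1 hv).1
  have hB'Y₁ : ∀ v ∈ B', ∀ i, f i v ∉ Y₁ := fun v hv i hi => hv.2 ⟨i, Or.inl hi⟩
  have hB'Y₂ : ∀ v ∈ B', ∀ i, f i v ∉ Y₂ := fun v hv i hi => hv.2 ⟨i, Or.inr hi⟩
  have hB'R : ∀ v ∈ B', v ∉ U → v ∉ R := by
    intro v hv hvU hvR
    exact hv.1.2 ⟨⟨⟨hvR, hv.1.1.1.2⟩, hvU⟩, fun ⟨i, hi⟩ => hB'Y₁ v hv i hi⟩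
  have hRMU : ∀ v ∈ R, v ∉ M → v ∈ U → v ∈ Y₁ :=
    fun v hvR hvM hvU => ⟨⟨⟨hvU, hRB hvR⟩, hMout v hvR hvM⟩, hvM⟩
  -- A point of `U ∩ B'` would lie outside `R`, so it would have a successor in `R ∩ U`, a set
  -- contained in `M ∪ Y₁`; either case excludes it from `B'`.
  have hB'U : ∀ v ∈ B', v ∉ U := by
    intro v hv hvU
    have hvM : v ∉ M := hv.1.1.1.2
    by_cases hvR : v ∈ R
    · exact hv.1.1.2 (hRMU v hvR hvM hvU)
    · obtain ⟨i, hlt, hi⟩ := hRout v hv.1.1.1.1 hvR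
      have hiU : f i v ∈ U := by
        by_contra h
        rw [hdU v hvU, hdO _ h] at hlt
        have := hN (f i v)
        omega
      by_cases hiM : f i v ∈ M
      · exact hv.1.1.2 ⟨⟨⟨hvU, hv.1.1.1.1⟩, i, hiM⟩, hvM⟩
      · exact hB'Y₁ v hv i (hRMU _ hi hiM hiU)
  have hYB : Y₁ ∪ Y₂ ∪ Y₃ ⊆ B := by
    rintro v ((hv | hv) | hv)
    · exact hv.1.1.2
    · exact hRB hv.1.1.1
    · exact (hY₃B' hv).1.1.1.1
  have hYM : ∀ v ∈ Y₁ ∪ Y₂ ∪ Y₃, v ∉ M := by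
    rintro v ((hv | hv) | hv)
    · exact hv.2
    · exact hv.1.1.2
    · exact (hY₃B' hv).1.1.1.2
  have hYU : ∀ v ∈ Y₁ ∪ Y₂ ∪ Y₃, v ∈ U → v ∈ Y₁ := by
    rintro v ((hv | hv) | hv) hvU
    · exact hv
    · exact absurd hvU hv.1.2
    · exact absurd hvU (hB'U v (hY₃B' hv))
  have hY₁Y : ∀ v ∈ Y₁, ∀ i, f i v ∉ Y₁ ∪ Y₂ ∪ Y₃ := by
    intro v hv i hi
    obtain ⟨a, b, hab, ha, hb⟩ := hexit v hv.1.1.1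
    obtain ⟨k, hk⟩ := hv.1.2
    have hkB := hRB (hMR hk)
    rcases Fin.eq_or_eq_or_eq_of_three hab (k := k) (by rintro rfl; exact ha hkB)
      (by rintro rfl; exact hb hkB) i with rfl | rfl | rfl
    · exact ha (hYB hi)
    · exact hb (hYB hi)
    · exact hYM _ hi hk
  -- Edges inside `Y` stay in `Y₂`, stay in `Y₃`, or go from `Y₂` to `Y₃`; the shift `N + 2` puts
  -- `Y₂` above `Y₃`.
  let r : V → ℕ := fun v => if v ∈ Y₃ then c v + 1 else if v ∈ Y₂ then c v + (N + 2) else 0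
  refine ⟨M, Y₁ ∪ Y₂ ∪ Y₃, (B \ M) \ (Y₁ ∪ Y₂ ∪ Y₃), r, hM, (hY₁.union hY₂).union hY₃,
    (hB.diff hM).diff ((hY₁.union hY₂).union hY₃),
    Measurable.ite hY₃ (hc.add_const _) (Measurable.ite hY₂ (hc.add_const _) measurable_const),
    ?_, ?_, ?_, ?_, hMind, ?_, ?_, ?_, ?_, ?_⟩
  · ext v
    constructor
    · rintro ((hv | hv) | hv)
      · exact hRB (hMR hv)
      · exact hYB hv
      · exact hv.1.1
    · intro hv
      by_cases hvM : v ∈ M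
      · exact Or.inl (Or.inl hvM)
      · by_cases hvY : v ∈ Y₁ ∪ Y₂ ∪ Y₃
        · exact Or.inl (Or.inr hvY)
        · exact Or.inr ⟨⟨hv, hvM⟩, hvY⟩
  · exact disjoint_left.2 fun v hvM hvY => hYM v hvY hvM
  · exact disjoint_left.2 fun v hvM hv => hv.1.2 hvM
  · exact disjoint_left.2 fun v hvY hv => hv.2 hvY
  · rintro y ((hy | hy) | hy)
    · obtain ⟨i, hi⟩ := hy.1.2
      exact ⟨i, Or.inl hi⟩
    · obtain ⟨i, hi⟩ := hMout y hy.1.1.1 hy.1.1.2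
      exact ⟨i, Or.inl hi⟩
    · have hy' := hY₃B' hy
      obtain ⟨i, -, hi⟩ := hRout y hy'.1.1.1.1 (hB'R y hy' (hB'U y hy'))
      refine ⟨i, ?_⟩
      by_cases hiM : f i y ∈ M
      · exact Or.inl hiM
      · refine Or.inr ⟨⟨hRB hi, hiM⟩, ?_⟩
        rintro ((h | h) | h)
        · exact hB'Y₁ y hy' i h
        · exact hB'Y₂ y hy' i h
        · exact hB'R _ (hY₃B' h) (hB'U _ (hY₃B' h)) hi
  · rintro z ⟨⟨hzB, hzM⟩, hzY⟩
    by_cases hz : z ∈ B'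
    · by_contra! h
      exact hzY (Or.inr ((hY₃mem z).2 ⟨hz, fun i _ hi => h i (Or.inr hi)⟩))
    · have : ∃ i, f i z ∈ Y₁ ∪ Y₂ := by
        by_contra h
        exact hz ⟨⟨⟨⟨hzB, hzM⟩, fun h => hzY (Or.inl (Or.inl h))⟩,
          fun h => hzY (Or.inl (Or.inr h))⟩, h⟩
      obtain ⟨i, hi⟩ := this
      exact ⟨i, Or.inl hi⟩
  · intro y hy hyU
    exact hY₁Y y (hYU y hy hyU)
  · rintro y ((hy | hy) | hy) hyU i hiU hi
    · exact hyU hy.1.1.1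
    · exact hy.2 ⟨i, hYU _ hi hiU⟩
    · exact hB'Y₁ y (hY₃B' hy) i (hYU _ hi hiU)
  · rintro y ((hy | hy) | hy) i hi hne
    · exact absurd hi (hY₁Y y hy i)
    · have hyY₃ : y ∉ Y₃ := fun h => (hY₃B' h).1.2 hy
      have hry : r y = c y + (N + 2) := by simp only [r, if_neg hyY₃, if_pos hy]
      rw [hry]
      have := hN (f i y)
      rcases hi with (hi | hi) | hi
      · exact absurd ⟨i, hi⟩ hy.2
      · have hiY₃ : f i y ∉ Y₃ := fun h => (hY₃B' h).1.2 hi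
        have hri : r (f i y) = c (f i y) + (N + 2) := by simp only [r, if_neg hiY₃, if_pos hi]
        have := hRdown y hy.1.1.1 i hi.1.1.1 hne
        rw [hdO _ hy.1.2, hdO _ hi.1.2] at this
        omega
      · have hri : r (f i y) = c (f i y) + 1 := by simp only [r, if_pos hi]
        omega
    · have hy' := hY₃B' hy
      have hry : r y = c y + 1 := by simp only [r, if_pos hy]
      rcases hi with (hi | hi) | hi
      · exact absurd hi (hB'Y₁ y hy' i)
      · exact absurd hi (hB'Y₂ y hy' i)
      · have hri : r (f i y) = c (f i y) + 1 := by simp only [r, if_pos hi]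
        have h1 := ((hY₃mem y).1 hy).2 i
        have h2 := hcol y i hne
        have : ¬ c y < c (f i y) := fun h => h1 h hi
        omega

end Combinatorics

/-! ### Three, five and eight independent sets. -/

section Colorings

open Set

variable {V : Type*} [MeasurableSpace V]

theorem measurableSet_exists_mem {ι : Type*} [Countable ι] {f : ι → V → V}
    (hf : ∀ i, Measurable (f i)) {S : Set V} (hS : MeasurableSet S) :
    MeasurableSet {v | ∃ i, f i v ∈ S} := by
  rw [ofPred_exists]
  exact MeasurableSet.iUnion fun i => hf i hS

variable {f : Fin 3 → V → V}

/-- If each point of `A` has at most one successor in `A ∪ Q`, each point of `Q` has at most two,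
and `Q` is independent, then `A ∪ Q` is the union of three independent sets. -/
theorem exists_three_isIndepFor_union (hf : ∀ i, Measurable (f i)) {c : V → ℕ} (hc : Measurable c)
    {N : ℕ} (hN : ∀ v, c v ≤ N) (hcol : ∀ v i, f i v ≠ v → c (f i v) ≠ c v) {A Q : Set V}
    (hA : MeasurableSet A) (hQ : MeasurableSet Q) (hAQ : Disjoint A Q) (hQi : IsIndepFor f Q)
    (hAe : ∀ v ∈ A, ∃ i j, i ≠ j ∧ f i v ∉ A ∪ Q ∧ f j v ∉ A ∪ Q)
    (hQe : ∀ v ∈ Q, ∃ i, f i v ∉ A ∪ Q) :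
    ∃ E S T : Set V, MeasurableSet E ∧ MeasurableSet S ∧ MeasurableSet T ∧ IsIndepFor f E ∧
      IsIndepFor f S ∧ IsIndepFor f T ∧ E ∪ S ∪ T = A ∪ Q := by
  classical
  have hex : ∀ {S : Set V}, MeasurableSet S → MeasurableSet {v | ∃ i, f i v ∈ S} :=
    measurableSet_exists_mem hf
  have hone : ∀ v ∈ A, ∀ j, f j v ∈ A ∪ Q → ∀ i, f i v ∈ A ∪ Q → i = j := by
    intro v hv j hj i hi
    obtain ⟨a, b, hab, ha, hb⟩ := hAe v hv
    rcases Fin.eq_or_eq_or_eq_of_three hab (k := j) (by rintro rfl; exact ha hj)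
      (by rintro rfl; exact hb hj) i with rfl | rfl | rfl
    · exact absurd hi ha
    · exact absurd hi hb
    · rfl
  let P : Set V := A ∩ {v | ∃ i, f i v ∈ Q}
  have hP : MeasurableSet P := hA.inter (hex hQ)
  obtain ⟨X, hX, hXmem⟩ := exists_measurableSet_greedy hf hc hN (hA.diff hP)
  have hXA : ∀ v ∈ X, v ∈ A ∧ v ∉ P := fun v hv => ((hXmem v).1 hv).1
  let E : Set V := (A \ P) \ X
  have hE : MeasurableSet E := (hA.diff hP).diff hX
  have hEX : ∀ v ∈ E, ∃ i, f i v ∈ X := by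
    rintro v ⟨hv, hvX⟩
    by_contra! h
    exact hvX ((hXmem v).2 ⟨hv, fun i _ => h i⟩)
  -- `D` collects the points of `Q` that cannot join `E`. A point of `P` whose successor is in `D`
  -- can join `E`, which may force further points of `Q` into `D`.
  let Φ : Set V → Set V := fun D => Q ∩ {v | ∃ i, f i v ∈ E ∪ P ∩ {p | ∃ j, f j p ∈ D}}
  obtain ⟨D, hD, hΦD⟩ : ∃ D, MeasurableSet D ∧ Φ D = D := by
    apply exists_measurableSet_fixedPoint
    · rintro C D hCD v ⟨hvQ, i, hi | ⟨hiP, j, hj⟩⟩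
      · exact ⟨hvQ, i, Or.inl hi⟩
      · exact ⟨hvQ, i, Or.inr ⟨hiP, j, hCD hj⟩⟩
    · exact fun C hC => hQ.inter (hex (hE.union (hP.inter (hex hC))))
    · rintro s - v ⟨hvQ, i, hi | ⟨hiP, j, hj⟩⟩
      · exact mem_iUnion.2 ⟨0, hvQ, i, Or.inl hi⟩
      · obtain ⟨n, hn⟩ := mem_iUnion.1 hj
        exact mem_iUnion.2 ⟨n, hvQ, i, Or.inr ⟨hiP, j, hn⟩⟩
  have hDQ : D ⊆ Q := fun v hv => (hΦD.symm.subset hv).1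
  have hDex : ∀ v ∈ D, ∃ i, f i v ∈ E ∪ P ∩ {p | ∃ j, f j p ∈ D} :=
    fun v hv => (hΦD.symm.subset hv).2
  have hnot : ∀ v ∈ A, v ∉ Q := fun v h h' => disjoint_left.1 hAQ h h'
  -- `E'` is one colour. Points of `D` now have a second exit from `X'`, into `E'`, so two colours
  -- suffice for `X'`.
  let E' : Set V := E ∪ P ∩ {p | ∃ j, f j p ∈ D} ∪ Q \ D
  let X' : Set V := X ∪ P \ {p | ∃ j, f j p ∈ D} ∪ D
  have hE' : MeasurableSet E' := (hE.union (hP.inter (hex hD))).union (hQ.diff hD)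
  have hX' : MeasurableSet X' := (hX.union (hP.diff (hex hD))).union hD
  have hunion : E' ∪ X' = A ∪ Q := by
    ext v
    constructor
    · rintro (((hv | hv) | hv) | ((hv | hv) | hv))
      · exact Or.inl hv.1.1
      · exact Or.inl hv.1.1
      · exact Or.inr hv.1
      · exact Or.inl (hXA v hv).1
      · exact Or.inl hv.1.1
      · exact Or.inr (hDQ hv)
    · rintro (hv | hv)
      · by_cases hvP : v ∈ P
        · by_cases hvD : v ∈ {p | ∃ j, f j p ∈ D}
          · exact Or.inl (Or.inl (Or.inr ⟨hvP, hvD⟩))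
          · exact Or.inr (Or.inl (Or.inr ⟨hvP, hvD⟩))
        · by_cases hvX : v ∈ X
          · exact Or.inr (Or.inl (Or.inl hvX))
          · exact Or.inl (Or.inl (Or.inl ⟨⟨hv, hvP⟩, hvX⟩))
      · by_cases hvD : v ∈ D
        · exact Or.inr (Or.inr hvD)
        · exact Or.inl (Or.inr ⟨hv, hvD⟩)
  have hdisj : ∀ v ∈ E', v ∉ X' := by
    rintro v ((hv | hv) | hv) ((hv' | hv') | hv')
    · exact hv.2 hv'
    · exact hv.1.2 hv'.1
    · exact hnot v hv.1.1 (hDQ hv')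
    · exact (hXA v hv').2 hv.1
    · exact hv'.2 hv.2
    · exact hnot v hv.1.1 (hDQ hv')
    · exact hnot v (hXA v hv').1 hv.1
    · exact hnot v hv'.1.1 hv.1
    · exact hv.2 hv'
  have hE'sub : ∀ v ∈ E', v ∈ A ∪ Q := fun v hv => hunion ▸ Or.inl hv
  have hX'sub : ∀ v ∈ X', v ∈ A ∪ Q := fun v hv => hunion ▸ Or.inr hv
  have hE'i : IsIndepFor f E' := by
    rintro v ((hv | hv) | hv) i hi
    · obtain ⟨k, hk⟩ := hEX v hv
      obtain rfl := hone v hv.1.1 k (Or.inl (hXA _ hk).1) i (hE'sub _ hi)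
      exact absurd (Or.inl (Or.inl hk)) (hdisj _ hi)
    · obtain ⟨k, hk⟩ := hv.2
      obtain rfl := hone v hv.1.1 k (Or.inr (hDQ hk)) i (hE'sub _ hi)
      exact absurd (Or.inr hk) (hdisj _ hi)
    · rcases hi with hi | hi
      · exact absurd (hΦD.subset ⟨hv.1, i, hi⟩) hv.2
      · exact hQi v hv.1 i hi.1
  -- Edges inside `X'` lead from `D` to `X` or `P`, or from `X` to `X` or `P`. The points of `P` in
  -- `X'` have no successor in `X'`.
  let r : V → ℕ := fun v => if v ∈ D then N + 2 else if v ∈ X then c v + 1 else 0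
  have hr : Measurable r :=
    Measurable.ite hD measurable_const (Measurable.ite hX (hc.add_const _) measurable_const)
  have hrD : ∀ v ∈ D, r v = N + 2 := fun v hv => if_pos hv
  have hrX : ∀ v ∈ X, r v = c v + 1 := fun v hv => by
    simp only [r, if_neg fun h => hnot v (hXA v hv).1 (hDQ h), if_pos hv]
  have hrP : ∀ v ∈ P, r v = 0 := fun v hv => by
    simp only [r, if_neg fun h => hnot v hv.1 (hDQ h), if_neg fun h => (hXA v h).2 hv]
  obtain ⟨S, T, hS, hT, hSi, hTi, -, hST⟩ := exists_two_isIndepFor hf hX' hr (by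
    rintro v ((hv | hv) | hv) i hi hne
    · rw [hrX v hv]
      rcases hi with (hi | hi) | hi
      · rw [hrX _ hi]
        have h1 := ((hXmem v).1 hv).2 i
        have h2 := hcol v i hne
        have : ¬ c v < c (f i v) := fun h => h1 h hi
        omega
      · rw [hrP _ hi.1]
        omega
      · exact absurd ⟨(hXA v hv).1, i, hDQ hi⟩ (hXA v hv).2
    · obtain ⟨k, hk⟩ := hv.1.2
      obtain rfl := hone v hv.1.1 k (Or.inr hk) i (hX'sub _ hi)
      refine absurd ⟨i, ?_⟩ hv.2
      rcases hi with (hi | hi) | hi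
      · exact absurd hk (hnot _ (hXA _ hi).1)
      · exact absurd hk (hnot _ hi.1.1)
      · exact hi
    · rw [hrD v hv]
      rcases hi with (hi | hi) | hi
      · rw [hrX _ hi]
        have := hN (f i v)
        omega
      · rw [hrP _ hi.1]
        omega
      · exact absurd (hQi v (hDQ hv) i (hDQ hi)) hne) (by
    rintro v ((hv | hv) | hv)
    · obtain ⟨a, b, hab, ha, hb⟩ := hAe v (hXA v hv).1
      exact ⟨a, b, hab, fun h => ha (hX'sub _ h), fun h => hb (hX'sub _ h)⟩
    · obtain ⟨a, b, hab, ha, hb⟩ := hAe v hv.1.1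
      exact ⟨a, b, hab, fun h => ha (hX'sub _ h), fun h => hb (hX'sub _ h)⟩
    · obtain ⟨a, ha⟩ := hQe v (hDQ hv)
      obtain ⟨b, hb⟩ := hDex v hv
      have hbE : f b v ∈ E' := Or.inl hb
      exact ⟨a, b, by rintro rfl; exact ha (hE'sub _ hbE), fun h => ha (hX'sub _ h), hdisj _ hbE⟩)
  exact ⟨E', S, T, hE', hS, hT, hE'i, hSi, hTi, by rw [union_assoc, hST, hunion]⟩

/-- If `K` is independent and each point of `A` has at most two successors in `A ∪ K`, then `A ∪ K` is
the union of five independent sets. -/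
theorem exists_five_isIndepFor_union (hf : ∀ i, Measurable (f i)) {c : V → ℕ} (hc : Measurable c)
    {N : ℕ} (hN : ∀ v, c v ≤ N) (hcol : ∀ v i, f i v ≠ v → c (f i v) ≠ c v) {A K : Set V}
    (hA : MeasurableSet A) (hK : MeasurableSet K) (hAK : Disjoint A K) (hKi : IsIndepFor f K)
    (hAe : ∀ v ∈ A, ∃ i, f i v ∉ A ∪ K) :
    ∃ S : Fin 5 → Set V, (∀ i, MeasurableSet (S i)) ∧ (∀ i, IsIndepFor f (S i)) ∧
      A ∪ K ⊆ ⋃ i, S i := by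
  have hex : ∀ {S : Set V}, MeasurableSet S → MeasurableSet {v | ∃ i, f i v ∈ S} :=
    measurableSet_exists_mem hf
  have hnot : ∀ v ∈ A, v ∉ K := fun v h h' => disjoint_left.1 hAK h h'
  -- These points have two successors outside `A`, one in `K` and one outside `A ∪ K`, so they can
  -- be made isolated in `Y` and coloured freely there.
  let U : Set V := A ∩ {v | ∃ i, f i v ∈ K}
  have hU : MeasurableSet U := hA.inter (hex hK)
  obtain ⟨M, Y, Z, r, hM, hY, hZ, hr, hMYZ, hMY, hMZ, hYZ, hMi, hYe, hZe, hYU, hYO, hYr⟩ :=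
    exists_decomposition hf hc hN hcol hA hU (by
      rintro u ⟨huA, j, hj⟩
      obtain ⟨i, hi⟩ := hAe u huA
      exact ⟨i, j, by rintro rfl; exact hi (Or.inr hj), fun h => hi (Or.inl h),
        fun h => hnot _ h hj⟩)
  have hMA : M ⊆ A := fun v hv => hMYZ ▸ Or.inl (Or.inl hv)
  have hYA : Y ⊆ A := fun v hv => hMYZ ▸ Or.inl (Or.inr hv)
  have hZA : Z ⊆ A := fun v hv => hMYZ ▸ Or.inr hv
  have hYMZ : ∀ v ∈ M ∪ Z, v ∉ Y := by
    rintro v (hv | hv) h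
    · exact disjoint_left.1 hMY hv h
    · exact disjoint_left.1 hYZ h hv
  obtain ⟨Y₀, Y₁, hY₀, hY₁, hY₀i, hY₁i, hYd, hY₀₁⟩ := exists_two_isIndepFor hf (hY.diff hU) hr
    (fun v hv i hi hne => hYr v hv.1 i hi.1 hne) (by
      rintro v ⟨hvY, -⟩
      obtain ⟨i, hi⟩ := hAe v (hYA hvY)
      obtain ⟨j, hj⟩ := hYe v hvY
      have hjA : f j v ∈ A := hj.elim (fun h => hMA h) fun h => hZA h
      exact ⟨i, j, by rintro rfl; exact hi (Or.inl hjA), fun h => hi (Or.inl (hYA h.1)),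
        fun h => hYMZ _ hj h.1⟩)
  have hY₀Y : ∀ v ∈ Y₀, v ∈ Y ∧ v ∉ U := fun v hv => hY₀₁.subset (Or.inl hv)
  have hY₁Y : ∀ v ∈ Y₁, v ∈ Y ∧ v ∉ U := fun v hv => hY₀₁.subset (Or.inr hv)
  have hnoK : ∀ v ∈ Y, v ∉ U → ∀ i, f i v ∉ K := fun v hv hvU i hi => hvU ⟨hYA hv, i, hi⟩
  -- a point of `Y ∩ U` has only one successor in `K`
  have huniq : ∀ v ∈ Y, v ∈ U → ∀ i j, f i v ∈ K → f j v ∈ K → i = j := by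
    intro v hvY hvU i j hi hj
    obtain ⟨a, ha⟩ := hAe v hvU.1
    obtain ⟨b, hb⟩ := hYe v hvY
    have hbA : f b v ∈ A := hb.elim (fun h => hMA h) fun h => hZA h
    have hai : a ≠ i := by rintro rfl; exact ha (Or.inr hi)
    have hbi : b ≠ i := by rintro rfl; exact hnot _ hbA hi
    rcases Fin.eq_or_eq_or_eq_of_three (k := i)
      (show a ≠ b by rintro rfl; exact ha (Or.inl hbA)) hai hbi j with rfl | rfl | rfl
    · exact absurd (Or.inr hj) ha
    · exact absurd hj (hnot _ hbA)
    · rfl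
  -- `F C` and `G C` are the two colours on `Y`. `C` is the part of `K` to receive the colour of `G
  -- C`, so a point of `Y ∩ U` with a successor in `C` takes the other colour.
  let F : Set V → Set V := fun C => Y₀ ∪ (Y ∩ U) ∩ {y | ∃ j, f j y ∈ C}
  let G : Set V → Set V := fun C => Y₁ ∪ (Y ∩ U) \ {y | ∃ j, f j y ∈ C}
  have hF : ∀ C, MeasurableSet C → MeasurableSet (F C) :=
    fun C hC => hY₀.union ((hY.inter hU).inter (hex hC))
  have hG : ∀ C, MeasurableSet C → MeasurableSet (G C) :=
    fun C hC => hY₁.union ((hY.inter hU).diff (hex hC))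
  have hFmono : Monotone F := by
    rintro C D hCD v (hv | ⟨hv, j, hj⟩)
    · exact Or.inl hv
    · exact Or.inr ⟨hv, j, hCD hj⟩
  have hGanti : Antitone G := by
    rintro C D hCD v (hv | ⟨hv, hj⟩)
    · exact Or.inl hv
    · exact Or.inr ⟨hv, fun ⟨j, h⟩ => hj ⟨j, hCD h⟩⟩
  -- Enlarging `C` enlarges `F C` and shrinks `G C`, so `Φ` is monotone. Continuity in the negative
  -- condition uses that there are only finitely many functions.
  let Φ : Set V → Set V := fun C => (K ∩ {v | ∃ i, f i v ∈ F C}) \ {v | ∃ i, f i v ∈ G C}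
  obtain ⟨C, hC, hΦC⟩ : ∃ C, MeasurableSet C ∧ Φ C = C := by
    apply exists_measurableSet_fixedPoint
    · rintro C D hCD v ⟨⟨hvK, i, hi⟩, hv⟩
      exact ⟨⟨hvK, i, hFmono hCD hi⟩, fun ⟨i, hi⟩ => hv ⟨i, hGanti hCD hi⟩⟩
    · exact fun C hC => (hK.inter (hex (hF C hC))).diff (hex (hG C hC))
    · rintro s hs v ⟨⟨hvK, i, hi⟩, hv⟩
      have h1 : ∀ᶠ n in Filter.atTop, f i v ∈ F (s n) := by
        rcases hi with hi | ⟨hi, j, hj⟩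
        · exact Filter.Eventually.of_forall fun n => Or.inl hi
        · filter_upwards [eventually_mem_of_mem_iUnion hs hj] with n hn
          exact Or.inr ⟨hi, j, hn⟩
      have h2 : ∀ k, ∀ᶠ n in Filter.atTop, f k v ∉ G (s n) := by
        intro k
        have hk : f k v ∉ G (⋃ n, s n) := fun h => hv ⟨k, h⟩
        have hk1 : f k v ∉ Y₁ := fun h => hk (Or.inl h)
        by_cases hkU : f k v ∈ Y ∩ U
        · have : ∃ j, f j (f k v) ∈ ⋃ n, s n := by
            by_contra h
            exact hk (Or.inr ⟨hkU, h⟩)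
          obtain ⟨j, hj⟩ := this
          filter_upwards [eventually_mem_of_mem_iUnion hs hj] with n hn
          rintro (h | h)
          · exact hk1 h
          · exact h.2 ⟨j, hn⟩
        · refine Filter.Eventually.of_forall fun n => ?_
          rintro (h | h)
          · exact hk1 h
          · exact hkU h.1
      obtain ⟨n, hn1, hn2⟩ := (h1.and (Filter.eventually_all.2 h2)).exists
      exact mem_iUnion.2 ⟨n, ⟨hvK, i, hn1⟩, fun ⟨k, hk⟩ => hn2 k hk⟩
  have hCmem : ∀ v ∈ C, (v ∈ K ∧ ∃ i, f i v ∈ F C) ∧ ¬ ∃ i, f i v ∈ G C :=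
    fun v hv => hΦC.symm.subset hv
  have hCK : C ⊆ K := fun v hv => (hCmem v hv).1.1
  have hFY : F C ⊆ Y := by
    rintro v (hv | hv)
    · exact (hY₀Y v hv).1
    · exact hv.1.1
  have hGY : G C ⊆ Y := by
    rintro v (hv | hv)
    · exact (hY₁Y v hv).1
    · exact hv.1.1
  have hYFG : Y ⊆ F C ∪ G C := by
    intro v hv
    by_cases hvU : v ∈ U
    · by_cases h : ∃ j, f j v ∈ C
      · exact Or.inl (Or.inr ⟨⟨hv, hvU⟩, h⟩)
      · exact Or.inr (Or.inr ⟨⟨hv, hvU⟩, h⟩)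
    · rcases hY₀₁.symm.subset ⟨hv, hvU⟩ with h | h
      · exact Or.inl (Or.inl h)
      · exact Or.inr (Or.inl h)
  -- `Ka` joins `F C` and `C` joins `G C`. What is left of `K` is `H`, whose points have a successor
  -- in each of the two colours, hence at most one outside `Y`.
  let Ka : Set V := K \ {v | ∃ i, f i v ∈ F C}
  have hKa : MeasurableSet Ka := hK.diff (hex (hF C hC))
  let H : Set V := (K \ Ka) \ C
  have hH : MeasurableSet H := (hK.diff hKa).diff hC
  have hFi : IsIndepFor f (F C ∪ Ka) := by
    rintro v ((hv | ⟨⟨hvY, hvU⟩, j, hj⟩) | hv) i hi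
    · obtain ⟨hvY, hvU⟩ := hY₀Y v hv
      rcases hi with (hi | hi) | hi
      · exact hY₀i v hv i hi
      · exact absurd hi.1.1 (hYO v hvY hvU i hi.1.2)
      · exact absurd hi.1 (hnoK v hvY hvU i)
    · rcases hi with hi | hi
      · exact absurd (hFY hi) (hYU v hvY hvU i)
      · obtain rfl := huniq v hvY hvU i j hi.1 (hCK hj)
        exact absurd (hCmem _ hj).1.2 hi.2
    · rcases hi with hi | hi
      · exact absurd ⟨i, hi⟩ hv.2
      · exact hKi v hv.1 i hi.1
  have hGi : IsIndepFor f (G C ∪ C) := by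
    rintro v ((hv | ⟨⟨hvY, hvU⟩, hj⟩) | hv) i hi
    · obtain ⟨hvY, hvU⟩ := hY₁Y v hv
      rcases hi with (hi | hi) | hi
      · exact hY₁i v hv i hi
      · exact absurd hi.1.1 (hYO v hvY hvU i hi.1.2)
      · exact absurd (hCK hi) (hnoK v hvY hvU i)
    · rcases hi with hi | hi
      · exact absurd (hGY hi) (hYU v hvY hvU i)
      · exact absurd ⟨i, hi⟩ hj
    · rcases hi with hi | hi
      · exact absurd ⟨i, hi⟩ (hCmem v hv).2
      · exact hKi v (hCK hv) i (hCK hi)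
  have hFG : ∀ v ∈ F C, v ∉ G C := by
    rintro v (hv | hv) (hv' | hv')
    · exact disjoint_left.1 hYd hv hv'
    · exact (hY₀Y v hv).2 hv'.1.2
    · exact (hY₁Y v hv').2 hv.1.2
    · exact hv'.2 hv.2
  have hYH : ∀ v ∈ Y, v ∉ Z ∪ H ∪ M := by
    rintro v hv ((h | h) | h)
    · exact hYMZ v (Or.inr h) hv
    · exact hnot v (hYA hv) h.1.1
    · exact hYMZ v (Or.inl h) hv
  have hsub : ∀ v ∈ Z ∪ H ∪ M, v ∈ A ∪ K := by
    rintro v ((h | h) | h)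
    · exact Or.inl (hZA h)
    · exact Or.inr h.1.1
    · exact Or.inl (hMA h)
  obtain ⟨E, S, T, hE, hS, hT, hEi, hSi, hTi, hEST⟩ :=
    exists_three_isIndepFor_union hf hc hN hcol (hZ.union hH) hM
      (disjoint_left.2 (by
        rintro v (h | h) hvM
        · exact disjoint_left.1 hMZ hvM h
        · exact hnot v (hMA hvM) h.1.1)) hMi (by
      rintro v (hv | hv)
      · obtain ⟨i, hi⟩ := hAe v (hZA hv)
        obtain ⟨j, hj⟩ := hZe v hv
        exact ⟨i, j, by rintro rfl; exact hi (Or.inl (hYA hj)), fun h => hi (hsub _ h),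
          hYH _ hj⟩
      · have h1 : ∃ i, f i v ∈ F C := by
          by_contra h
          exact hv.1.2 ⟨hv.1.1, h⟩
        have h2 : ∃ i, f i v ∈ G C := by
          by_contra h
          exact hv.2 (hΦC.subset ⟨⟨hv.1.1, h1⟩, h⟩)
        obtain ⟨i, hi⟩ := h1
        obtain ⟨j, hj⟩ := h2
        exact ⟨i, j, by rintro rfl; exact hFG _ hi hj, hYH _ (hFY hi), hYH _ (hGY hj)⟩)
      (fun v hv => by
        obtain ⟨i, hi⟩ := hAe v (hMA hv)
        exact ⟨i, fun h => hi (hsub _ h)⟩)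
  refine ⟨![F C ∪ Ka, G C ∪ C, E, S, T], ?_, ?_, ?_⟩
  · simp only [Fin.forall_fin_succ, Matrix.cons_val_zero, Matrix.cons_val_succ, IsEmpty.forall_iff,
      and_true]
    exact ⟨(hF C hC).union hKa, (hG C hC).union hC, hE, hS, hT⟩
  · simp only [Fin.forall_fin_succ, Matrix.cons_val_zero, Matrix.cons_val_succ, IsEmpty.forall_iff,
      and_true]
    exact ⟨hFi, hGi, hEi, hSi, hTi⟩
  · have hE' : ∀ v ∈ Z ∪ H ∪ M, v ∈ ⋃ i, (![F C ∪ Ka, G C ∪ C, E, S, T] : Fin 5 → Set V) i := by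
      intro v hv
      rw [← hEST] at hv
      rcases hv with (hv | hv) | hv
      · exact mem_iUnion.2 ⟨2, hv⟩
      · exact mem_iUnion.2 ⟨3, hv⟩
      · exact mem_iUnion.2 ⟨4, hv⟩
    rintro v (hv | hv)
    · rw [← hMYZ] at hv
      rcases hv with (hv | hv) | hv
      · exact hE' v (Or.inr hv)
      · rcases hYFG hv with h | h
        · exact mem_iUnion.2 ⟨0, Or.inl h⟩
        · exact mem_iUnion.2 ⟨1, Or.inl h⟩
      · exact hE' v (Or.inl (Or.inl hv))
    · by_cases h1 : v ∈ Ka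
      · exact mem_iUnion.2 ⟨0, Or.inr h1⟩
      · by_cases h2 : v ∈ C
        · exact mem_iUnion.2 ⟨1, Or.inr h2⟩
        · exact hE' v (Or.inl (Or.inr ⟨⟨hv, h1⟩, h2⟩))

/-- Finitely many measurable independent sets that cover the space give a measurable colouring. -/
theorem exists_coloring_of_isIndepFor {ι : Type*} {m : ℕ} {f : ι → V → V} {S : Fin m → Set V}
    (hS : ∀ a, MeasurableSet (S a)) (hi : ∀ a, IsIndepFor f (S a)) (hcov : ∀ v, ∃ a, v ∈ S a) :
    ∃ g : V → Fin m, (∀ a, MeasurableSet {v | g v = a}) ∧ ∀ v i, f i v ≠ v → g (f i v) ≠ g v := by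
  have hmin : ∀ v, ∃ a, v ∈ S a ∧ ∀ b < a, v ∉ S b := by
    intro v
    obtain ⟨a, ha, hmin⟩ := WellFounded.has_min (wellFounded_lt (α := Fin m)) {a | v ∈ S a} (hcov v)
    exact ⟨a, ha, fun b hb hvb => hmin b hvb hb⟩
  choose g hg hlt using hmin
  refine ⟨g, fun a => ?_, fun v i hne hgv => hne (hi (g v) v (hg v) i ?_)⟩
  · have : {v | g v = a} = S a ∩ ⋂ b, ⋂ (_ : b < a), (S b)ᶜ := by
      ext v
      simp only [mem_inter_iff, mem_iInter, mem_compl_iff, mem_ofPred_eq]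
      constructor
      · rintro rfl
        exact ⟨hg v, hlt v⟩
      · rintro ⟨h1, h2⟩
        refine le_antisymm (not_lt.1 fun h => hlt v a h h1) (not_lt.1 fun h => h2 _ h (hg v))
    rw [this]
    exact (hS a).inter (MeasurableSet.iInter fun b => MeasurableSet.iInter fun _ => (hS b).compl)
  · rw [← hgv]
    exact hg (f i v)

/-- A graph generated by three measurable functions with a finite measurable colouring has a
measurable colouring with eight colours. -/
theorem exists_eight_coloring (hf : ∀ i, Measurable (f i)) {c : V → ℕ} (hc : Measurable c)
    {N : ℕ} (hN : ∀ v, c v ≤ N) (hcol : ∀ v i, f i v ≠ v → c (f i v) ≠ c v) :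
    ∃ g : V → Fin 8, (∀ a, MeasurableSet {v | g v = a}) ∧ ∀ v i, f i v ≠ v → g (f i v) ≠ g v := by
  -- At this first level `U` is empty: no successors outside the whole space are available.
  obtain ⟨K, W, A, r, hK, hW, hA, hr, hKWA, hKW, hKA, hWA, hKi, hWe, hAe, -, -, hWr⟩ :=
    exists_decomposition hf hc hN hcol MeasurableSet.univ MeasurableSet.empty
      (fun u hu => absurd hu (notMem_empty u))
  have hKAW : ∀ v ∈ K ∪ A, v ∉ W := by
    rintro v (hv | hv) h
    · exact disjoint_left.1 hKW hv h
    · exact disjoint_left.1 hWA h hv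
  obtain ⟨S₀, S₁, S₂, h₀, h₁, h₂, hi₀, hi₁, hi₂, hS⟩ := exists_three_isIndepFor hf hW hr hWr
    (fun v hv => (hWe v hv).imp fun i hi => hKAW _ hi)
  obtain ⟨S, hSm, hSi, hcov⟩ := exists_five_isIndepFor_union hf hc hN hcol hA hK hKA.symm hKi
    (fun v hv => (hAe v hv).imp fun i hi h => hKAW _ h.symm hi)
  let T : Fin (3 + 5) → Set V := Fin.append ![S₀, S₁, S₂] S
  have hT : ∀ p : Set V → Prop, p S₀ → p S₁ → p S₂ → (∀ a, p (S a)) → ∀ a, p (T a) := by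
    intro p hp₀ hp₁ hp₂ hp a
    induction a using Fin.addCases with
    | left a =>
      simp only [T, Fin.append_left]
      fin_cases a
      exacts [hp₀, hp₁, hp₂]
    | right a =>
      simp only [T, Fin.append_right]
      exact hp a
  have hTl : ∀ a : Fin 3, T (Fin.castAdd 5 a) = (![S₀, S₁, S₂] : Fin 3 → Set V) a :=
    Fin.append_left _ _
  have hTr : ∀ a, T (Fin.natAdd 3 a) = S a := Fin.append_right _ _
  refine exists_coloring_of_isIndepFor (m := 3 + 5) (S := T) (hT _ h₀ h₁ h₂ hSm)
    (hT _ hi₀ hi₁ hi₂ hSi) fun v => ?_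
  have hcov' : v ∈ A ∪ K → ∃ a, v ∈ T a := by
    intro hv
    obtain ⟨a, ha⟩ := mem_iUnion.1 (hcov hv)
    exact ⟨Fin.natAdd 3 a, (hTr a).symm.subset ha⟩
  rcases hKWA.symm.subset (mem_univ v) with (hv | hv) | hv
  · exact hcov' (Or.inr hv)
  · rw [← hS] at hv
    rcases hv with (hv | hv) | hv
    · exact ⟨Fin.castAdd 5 0, (hTl 0).symm.subset hv⟩
    · exact ⟨Fin.castAdd 5 1, (hTl 1).symm.subset hv⟩
    · exact ⟨Fin.castAdd 5 2, (hTl 2).symm.subset hv⟩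
  · exact hcov' (Or.inl hv)

end Colorings

/-! ### Projective classes and the σ-algebra of ambiguous sets. -/

section Projective

open Set MeasureTheory TopologicalSpace

/-- The three closure properties need a joint induction. For intersections, one point of the Baire
space codes a sequence of witnesses through `Nat.pair`; decoding is continuous, so preimages and,
after complementing, unions one level down are needed. -/
theorem isSigmaOne_iUnion_iInter_preimage (n : ℕ) :
    (∀ (X : Type u) [TopologicalSpace X] [PolishSpace X] (A : ℕ → Set X),
      (∀ k, IsSigmaOne n X (A k)) → IsSigmaOne n X (⋃ k, A k)) ∧
    (∀ (X : Type u) [TopologicalSpace X] [PolishSpace X] (A : ℕ → Set X),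
      (∀ k, IsSigmaOne n X (A k)) → IsSigmaOne n X (⋂ k, A k)) ∧
    (∀ (X Y : Type u) [TopologicalSpace X] [PolishSpace X] [TopologicalSpace Y] [PolishSpace Y]
      (g : X → Y), Continuous g → ∀ A, IsSigmaOne n Y A → IsSigmaOne n X (g ⁻¹' A)) := by
  induction n with
  | zero =>
    exact ⟨fun X _ _ A h => AnalyticSet.iUnion h, fun X _ _ A h => AnalyticSet.iInter h,
      fun X Y _ _ _ _ g hg A h => AnalyticSet.preimage h hg⟩
  | succ n ih =>
    obtain ⟨ihU, ihI, ihP⟩ := ih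
    refine ⟨fun X _ _ A h => ?_, fun X _ _ A h => ?_, fun X Y _ _ _ _ g hg A h => ?_⟩
    · choose B hB hBA using h
      refine ⟨⋃ k, B k, ?_, ?_⟩
      · rw [compl_iUnion]
        exact ihI _ _ hB
      · rw [image_iUnion]
        simp_rw [hBA]
    · choose B hB hBA using h
      let g : ℕ → (ℕ → ℕ) × X → (ℕ → ℕ) × X := fun k p => (fun m => p.1 (Nat.pair k m), p.2)
      have hg : ∀ k, Continuous (g k) := by
        intro k
        fun_prop
      refine ⟨⋂ k, g k ⁻¹' B k, ?_, ?_⟩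
      · rw [compl_iInter]
        exact ihU _ _ fun k => ihP _ _ (g k) (hg k) _ (hB k)
      · ext x
        constructor
        · rintro ⟨⟨z, x⟩, hz, rfl⟩
          refine mem_iInter.2 fun k => ?_
          rw [← hBA k]
          exact ⟨g k (z, x), mem_iInter.1 hz k, rfl⟩
        · intro hx
          have : ∀ k, ∃ z : ℕ → ℕ, (z, x) ∈ B k := by
            intro k
            have := mem_iInter.1 hx k
            rw [← hBA k] at this
            obtain ⟨⟨z, x⟩, hz, rfl⟩ := this
            exact ⟨z, hz⟩
          choose z hz using this
          refine ⟨(fun m => z m.unpair.1 m.unpair.2, x), mem_iInter.2 fun k => ?_, rfl⟩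
          simpa [g] using hz k
    · obtain ⟨B, hB, rfl⟩ := h
      let g' : (ℕ → ℕ) × X → (ℕ → ℕ) × Y := fun p => (p.1, g p.2)
      have hg' : Continuous g' := by fun_prop
      refine ⟨g' ⁻¹' B, ihP _ _ g' hg' _ hB, ?_⟩
      ext x
      constructor
      · rintro ⟨⟨z, x⟩, hz, rfl⟩
        exact ⟨g' (z, x), hz, rfl⟩
      · rintro ⟨⟨z, y⟩, hz, hy⟩
        exact ⟨(z, x), by simpa [g', ← hy] using hz, rfl⟩

namespace IsSigmaOne

variable {n : ℕ} {X Y : Type u} [TopologicalSpace X] [PolishSpace X] [TopologicalSpace Y]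
  [PolishSpace Y]

theorem iUnion {A : ℕ → Set X} (h : ∀ k, IsSigmaOne n X (A k)) : IsSigmaOne n X (⋃ k, A k) :=
  (isSigmaOne_iUnion_iInter_preimage n).1 X A h

theorem iInter {A : ℕ → Set X} (h : ∀ k, IsSigmaOne n X (A k)) : IsSigmaOne n X (⋂ k, A k) :=
  (isSigmaOne_iUnion_iInter_preimage n).2.1 X A h

theorem preimage {A : Set Y} (h : IsSigmaOne n Y A) {g : X → Y} (hg : Continuous g) :
    IsSigmaOne n X (g ⁻¹' A) :=
  (isSigmaOne_iUnion_iInter_preimage n).2.2 X Y g hg A h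

theorem empty : IsSigmaOne n X (∅ : Set X) :=
  isSigmaOne_of_isOpen_or_isClosed n X ∅ (Or.inl isOpen_empty)

theorem univ : IsSigmaOne n X (univ : Set X) :=
  isSigmaOne_of_isOpen_or_isClosed n X Set.univ (Or.inl isOpen_univ)

theorem iUnion_of_countable {ι : Type*} [Countable ι] {A : ι → Set X}
    (h : ∀ k, IsSigmaOne n X (A k)) : IsSigmaOne n X (⋃ k, A k) := by
  rcases isEmpty_or_nonempty ι with hι | hι
  · rw [iUnion_of_empty]
    exact empty
  · obtain ⟨e, he⟩ := exists_surjective_nat ι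
    rw [← he.iUnion_comp]
    exact iUnion fun k => h (e k)

theorem iInter_of_countable {ι : Type*} [Countable ι] {A : ι → Set X}
    (h : ∀ k, IsSigmaOne n X (A k)) : IsSigmaOne n X (⋂ k, A k) := by
  rcases isEmpty_or_nonempty ι with hι | hι
  · rw [iInter_of_empty]
    exact univ
  · obtain ⟨e, he⟩ := exists_surjective_nat ι
    rw [← he.iInter_comp]
    exact iInter fun k => h (e k)

theorem inter {A B : Set X} (hA : IsSigmaOne n X A) (hB : IsSigmaOne n X B) :
    IsSigmaOne n X (A ∩ B) := by
  rw [inter_eq_iInter]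
  exact iInter_of_countable fun b => by cases b <;> assumption

theorem union {A B : Set X} (hA : IsSigmaOne n X A) (hB : IsSigmaOne n X B) :
    IsSigmaOne n X (A ∪ B) := by
  rw [union_eq_iUnion]
  exact iUnion_of_countable fun b => by cases b <;> assumption

theorem image_snd_baire {A : Set ((ℕ → ℕ) × X)} (h : IsSigmaOne n ((ℕ → ℕ) × X) A) :
    IsSigmaOne n X (Prod.snd '' A) := by
  cases n with
  | zero => exact AnalyticSet.image_of_continuous h continuous_snd
  | succ n =>
    obtain ⟨B, hB, rfl⟩ := h
    -- Two successive projections merge into one by coding two witnesses as one.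
    let g : (ℕ → ℕ) × X → (ℕ → ℕ) × (ℕ → ℕ) × X :=
      fun p => (fun m => p.1 (Nat.pair 0 m), fun m => p.1 (Nat.pair 1 m), p.2)
    have hg : Continuous g := by fun_prop
    refine ⟨g ⁻¹' B, preimage hB hg, ?_⟩
    ext x
    constructor
    · rintro ⟨⟨z, x⟩, hz, rfl⟩
      exact ⟨_, ⟨_, hz, rfl⟩, rfl⟩
    · rintro ⟨_, ⟨⟨w, z, x⟩, hB, rfl⟩, rfl⟩
      refine ⟨(fun m => if m.unpair.1 = 0 then w m.unpair.2 else z m.unpair.2, x), ?_, rfl⟩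
      simpa [g] using hB

theorem image_snd {A : Set (Y × X)} (h : IsSigmaOne n (Y × X) A) :
    IsSigmaOne n X (Prod.snd '' A) := by
  rcases isEmpty_or_nonempty Y with hY | hY
  · rw [eq_empty_of_isEmpty A, image_empty]
    exact empty
  · obtain ⟨π, hπ, hsurj⟩ := PolishSpace.exists_nat_nat_continuous_surjective Y
    let g : (ℕ → ℕ) × X → Y × X := fun p => (π p.1, p.2)
    have hg : Continuous g := by fun_prop
    have : Prod.snd '' A = Prod.snd '' (g ⁻¹' A) := by
      ext x
      constructor
      · rintro ⟨⟨y, x⟩, hy, rfl⟩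
        obtain ⟨z, rfl⟩ := hsurj y
        exact ⟨(z, x), hy, rfl⟩
      · rintro ⟨⟨z, x⟩, hz, rfl⟩
        exact ⟨_, hz, rfl⟩
    rw [this]
    exact image_snd_baire (preimage h hg)

/-- The preimage of a `Σ¹_{n+1}` set under a function with a `Σ¹_{n+1}` graph. -/
theorem preimage_of_graph {g : X → Y} (hg : IsSigmaOne n (Y × X) {p | g p.2 = p.1}) {A : Set Y}
    (hA : IsSigmaOne n Y A) : IsSigmaOne n X (g ⁻¹' A) := by
  have : g ⁻¹' A = Prod.snd '' ({p : Y × X | g p.2 = p.1} ∩ Prod.fst ⁻¹' A) := by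
    ext x
    constructor
    · intro hx
      exact ⟨(g x, x), ⟨rfl, hx⟩, rfl⟩
    · rintro ⟨⟨y, x⟩, ⟨h, hy⟩, rfl⟩
      have h' : g x = y := h
      rw [mem_preimage, h']
      exact hy
  rw [this]
  exact image_snd (hg.inter (hA.preimage continuous_fst))

end IsSigmaOne

namespace LusinPointclass

/-- The level of a Lusin pointclass in the projective hierarchy. -/
def level : LusinPointclass → ℕ
  | sigma n => n
  | pi n => n
  | delta n => n

theorem mem_of_delta {X : Type u} [TopologicalSpace X] (P : LusinPointclass) {A : Set X}
    (h : (delta P.level).Mem A) : P.Mem A := by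
  cases P with
  | sigma n => exact h.1
  | pi n => exact h.2
  | delta n => exact h

variable {X Y : Type u} [TopologicalSpace X] [PolishSpace X] [TopologicalSpace Y] [PolishSpace Y]

/-- Points are separated by basic open sets, in either direction. So `g x = y` holds if every basic
`U` containing `y` contains `g x`, and also if every basic `U` containing `g x` contains `y`. The
first form suits preimages in `Σ`, the second preimages in `Π`. -/
theorem IsFunction.isSigmaOne_graph {P : LusinPointclass} {g : X → Y} (hg : P.IsFunction g) :
    IsSigmaOne P.level (Y × X) {p | g p.2 = p.1} := by
  have hsep : ∀ y z : Y, y ≠ z → ∃ U ∈ countableBasis Y, y ∈ U ∧ z ∉ U := by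
    intro y z hyz
    obtain ⟨U, hU, hy, hz⟩ := (isBasis_countableBasis Y).exists_subset_of_mem_open
      (show y ∈ ({z} : Set Y)ᶜ from hyz) isOpen_compl_singleton
    exact ⟨U, hU, hy, fun h => hz h rfl⟩
  have hpi : (∀ U : Set Y, IsOpen U → IsSigmaOne P.level X (g ⁻¹' U)) ∨
      ∀ U : Set Y, IsOpen U → IsSigmaOne P.level X (g ⁻¹' U)ᶜ := by
    cases P with
    | sigma n => exact Or.inl hg
    | pi n => exact Or.inr hg
    | delta n => exact Or.inl fun U hU => (hg U hU).1
  have hopen : ∀ U : countableBasis Y, IsOpen (U : Set Y) :=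
    fun U => (isBasis_countableBasis Y).isOpen U.2
  have : Countable (countableBasis Y) := (countable_countableBasis Y).to_subtype
  rcases hpi with h | h
  · have : {p : Y × X | g p.2 = p.1} = ⋂ U : countableBasis Y,
        (Prod.fst ⁻¹' (U : Set Y)ᶜ ∪ Prod.snd ⁻¹' (g ⁻¹' (U : Set Y))) := by
      ext ⟨y, x⟩
      simp only [mem_ofPred_eq, mem_iInter, mem_union, mem_preimage, mem_compl_iff]
      constructor
      · rintro rfl U
        exact (em _).symm
      · intro hU
        by_contra hne
        obtain ⟨U, hU', hy, hz⟩ := hsep y (g x) (Ne.symm hne)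
        exact (hU ⟨U, hU'⟩).elim (fun h => h hy) hz
    rw [this]
    exact IsSigmaOne.iInter_of_countable fun U =>
      (isSigmaOne_of_isOpen_or_isClosed _ _ _
        (Or.inr ((hopen U).isClosed_compl.preimage continuous_fst))).union
        ((h U (hopen U)).preimage continuous_snd)
  · have : {p : Y × X | g p.2 = p.1} = ⋂ U : countableBasis Y,
        (Prod.fst ⁻¹' (U : Set Y) ∪ Prod.snd ⁻¹' (g ⁻¹' (U : Set Y))ᶜ) := by
      ext ⟨y, x⟩
      simp only [mem_ofPred_eq, mem_iInter, mem_union, mem_preimage, mem_compl_iff]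
      constructor
      · rintro rfl U
        exact em _
      · intro hU
        by_contra hne
        obtain ⟨U, hU', hy, hz⟩ := hsep (g x) y hne
        exact (hU ⟨U, hU'⟩).elim hz (fun h => h hy)
    rw [this]
    exact IsSigmaOne.iInter_of_countable fun U =>
      (isSigmaOne_of_isOpen_or_isClosed _ _ _
        (Or.inl ((hopen U).preimage continuous_fst))).union
        ((h U (hopen U)).preimage continuous_snd)

/-- This is what makes `P` functions measurable for the σ-algebra of `Δ` sets, even when `P` itself
is not closed under complements. -/
theorem IsFunction.delta_mem_preimage {P : LusinPointclass} {g : X → Y} (hg : P.IsFunction g)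
    {A : Set Y} (hA : (delta P.level).Mem A) : (delta P.level).Mem (g ⁻¹' A) :=
  ⟨IsSigmaOne.preimage_of_graph hg.isSigmaOne_graph hA.1,
    IsSigmaOne.preimage_of_graph hg.isSigmaOne_graph hA.2⟩

/-- The `σ`-algebra of the `Δ¹_{n+1}` subsets of a Polish space. -/
abbrev deltaMeasurableSpace (n : ℕ) (X : Type u) [TopologicalSpace X] [PolishSpace X] :
    MeasurableSpace X where
  MeasurableSet' A := (delta n).Mem A
  measurableSet_empty := mem_of_isOpen_or_isClosed _ _ (Or.inl isOpen_empty)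
  measurableSet_compl A hA := ⟨hA.2, by rw [compl_compl]; exact hA.1⟩
  measurableSet_iUnion A hA := ⟨IsSigmaOne.iUnion fun k => (hA k).1, by
    rw [compl_iUnion]; exact IsSigmaOne.iInter fun k => (hA k).2⟩

/-- The classes of a finite partition into sets of `P` are in the ambiguous class of `P`. -/
theorem delta_mem_of_finite {P : LusinPointclass} {A : Type u} [Finite A] {c : X → A}
    (hc : ∀ a, P.Mem {v | c v = a}) (a : A) : (delta P.level).Mem {v | c v = a} := by
  have hcompl : {v | c v = a}ᶜ = ⋃ b : {b // b ≠ a}, {v | c v = (b : A)} := by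
    ext v
    simp
  cases P with
  | sigma n =>
    refine ⟨hc a, ?_⟩
    rw [hcompl]
    exact IsSigmaOne.iUnion_of_countable fun b => hc b
  | pi n =>
    refine ⟨?_, hc a⟩
    rw [← compl_compl {v | c v = a}, hcompl, compl_iUnion]
    exact IsSigmaOne.iInter_of_countable fun b => hc b
  | delta n => exact hc a

end LusinPointclass

end Projective

/-! ### Transfer to Lusin pointclasses. -/

theorem LusinPointclass.exists_eight_coloring_of_generatedGraph {V : Type u} [TopologicalSpace V]
    [PolishSpace V] {P : LusinPointclass} {f : Fin 3 → V → V} (hf : ∀ i, P.IsFunction (f i))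
    {A : Type u} [Finite A] {c : (generatedGraph f).Coloring A} (hc : P.IsClassColoring c) :
    ∃ g : (generatedGraph f).Coloring (ULift.{u} (Fin 8)), P.IsClassColoring g := by
  -- Finiteness of `A` puts the classes of `c` in `Δ`. The eight new classes are then in `Δ`, which
  -- is contained in `P`.
  let _ := deltaMeasurableSpace P.level V
  have hfm : ∀ i, Measurable (f i) := fun i S hS => (hf i).delta_mem_preimage hS
  have hcm : Measurable fun v => (Finite.equivFin A (c v) : ℕ) := by
    refine measurable_to_countable' fun n => ?_
    have : (fun v => (Finite.equivFin A (c v) : ℕ)) ⁻¹' {n} =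
        ⋃ a : {a : A // (Finite.equivFin A a : ℕ) = n}, {v | c v = (a : A)} := by
      ext v
      simp
    rw [this]
    exact MeasurableSet.iUnion fun a => delta_mem_of_finite hc (a : A)
  obtain ⟨g, hg, hgf⟩ := exists_eight_coloring hfm hcm (fun v => (Finite.equivFin A (c v)).2.le)
    (fun v i hne h => c.valid (show (generatedGraph f).Adj v (f i v) from ⟨hne.symm, i, Or.inl rfl⟩)
      ((Finite.equivFin A).injective (Fin.ext h)).symm)
  refine ⟨SimpleGraph.Coloring.mk (fun v => ULift.up (g v)) ?_, fun a => P.mem_of_delta ?_⟩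
  · rintro v w ⟨hne, i, rfl | rfl⟩ h
    · exact hgf v i hne.symm (ULift.up_injective h).symm
    · exact hgf w i hne (ULift.up_injective h)
  · have : {v | ULift.up (g v) = a} = {v | g v = a.down} := by
      ext v
      exact ULift.ext_iff
    exact this ▸ hg a.down

theorem theorem3p14 {V : Type u} [TopologicalSpace V] [PolishSpace V] (P : LusinPointclass)
    (f : Fin 3 → V → V) (hf : ∀ i, P.IsFunction (f i)) :
    P.chromaticNumber (generatedGraph f) ≤ 8 ∨ ℵ₀ ≤ P.chromaticNumber (generatedGraph f) := by
  refine or_iff_not_imp_right.2 fun h => ?_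
  obtain ⟨A, c, hA, hc⟩ := P.exists_coloring_card_eq_chromaticNumber (generatedGraph f)
  have : Finite A := lt_aleph0_iff_finite.1 (hA ▸ not_le.1 h)
  obtain ⟨g, hg⟩ := LusinPointclass.exists_eight_coloring_of_generatedGraph hf hc
  exact csInf_le' ⟨ULift (Fin 8), g, by simp, hg⟩
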